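/- Let $p \geq 3$ be a prime, let $M = \mathrm{M}_2(\mathbb{F}_p)$ be the multiplicative monoid of all $2\times 2$ matrices over $\mathbb{F}_p$, and let $\Gamma = \mathrm{GL}_2(\mathbb{F}_p)$. For $n \geq 0$ let $V_n$ be the space of homogeneous polynomials of degree $n$ in $\mathbb{F}_p[X,Y]$, on which $M$ acts by $\begin{pmatrix} a & b \\ c & d \end{pmatrix}\cdot F(X,Y) = F(aX+cY,\, bX+dY)$. For $0 \leq j \leq n$ let $X_{n-j,\,n} \subseteq V_n$ be the $\mathbb{F}_p[\Gamma]$-submodule generated by $X^{n-j}Y^{j}$; for $j \leq p-1$ it is stable under $M$. Let $\Sigma_p(n)$ denote the sum of the digits of $n$ in base $p$. $M$ acts diagonally on tensor products over $\mathbb{F}_p$. Let $r \geq p$, let $r_0 \in \{0,\dots,p-1\}$ be the residue of $r$ modulo $p$, and let $0 \leq i \leq r_0$. Then, as $M$-modules, $$X_{r-i,\,r} \cong \begin{cases} X_{r-s,\,r-s} \otimes V_{s}, \text{ where } s = \Sigma_p(r-r_0), & \text{if } \Sigma_p(r-i) < r_0,\\ X_{r-i,\,r-i} \otimes V_i, &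 \text{if } \Sigma_p(r-i) \geq r_0.\end{cases}$$ Moreover $$\dim_{\mathbb{F}_p} X_{r-i,\,r} = \begin{cases} (r_0+1)(\Sigma_p(r-r_0)+1), & \text{if } \Sigma_p(r-i) < r_0,\\ (i+1)(\Sigma_p(r-i)+1), & \text{if } r_0 \leq \Sigma_p(r-i) \leq p,\\ (i+1)(p+1), & \text{if } \Sigma_p(r-i) \geq p.\end{cases}$$ -/

import Mathlib

open scoped TensorProduct

namespace MonomialModules

/-- The semigroup `M = M₂(𝔽_p)` of all two by two matrices over `𝔽_p`. -/
abbrev Mat (p : ℕ) : Type := Matrix (Fin 2) (Fin 2) (ZMod p)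

/-- The polynomial ring `𝔽_p[X, Y]`, with `X = X 0` and `Y = X 1`. -/
abbrev Poly (p : ℕ) : Type := MvPolynomial (Fin 2) (ZMod p)

/-- The substitution `F(X, Y) ↦ F(aX + cY, bX + dY)` attached to the matrix with rows
`(a, b)` and `(c, d)`. -/
noncomputable def subst (p : ℕ) (m : Mat p) : Poly p →ₐ[ZMod p] Poly p :=
  MvPolynomial.aeval fun j : Fin 2 =>
    MvPolynomial.C (m 0 j) * MvPolynomial.X 0 + MvPolynomial.C (m 1 j) * MvPolynomial.X 1

/-- The action of `M` on `𝔽_p[X, Y]` by linear substitutions. -/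
noncomputable def polyRep (p : ℕ) : Representation (ZMod p) (Mat p) (Poly p) where
  toFun m := (subst p m).toLinearMap
  map_one' := by
    have h : subst p 1 = AlgHom.id (ZMod p) (Poly p) := by
      ext j
      fin_cases j <;> simp [subst]
    rw [h]
    rfl
  map_mul' m n := by
    have h : subst p (m * n) = (subst p m).comp (subst p n) := by
      apply MvPolynomial.algHom_ext
      intro j
      simp only [subst, AlgHom.comp_apply, MvPolynomial.aeval_X, map_add, map_mul,
        MvPolynomial.algHom_C, MvPolynomial.algebraMap_eq, Matrix.mul_apply, Fin.sum_univ_two]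
      ring
    rw [h]
    rfl

theorem polyRep_apply (p : ℕ) (m : Mat p) (F : Poly p) : polyRep p m F = subst p m F := rfl

theorem polyRep_mul (p : ℕ) (m n : Mat p) (F : Poly p) :
    polyRep p (m * n) F = polyRep p m (polyRep p n F) := by
  rw [map_mul, Module.End.mul_apply]

/-- `V_r`: the homogeneous polynomials of degree `r`, as an `M`-stable subspace
of `𝔽_p[X, Y]`. -/
noncomputable def V (p r : ℕ) : Subrepresentation (polyRep p) where
  toSubmodule := MvPolynomial.homogeneousSubmodule (Fin 2) (ZMod p) r
  apply_mem_toSubmodule m F hF := by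
    have h := MvPolynomial.IsHomogeneous.aeval
      ((MvPolynomial.mem_homogeneousSubmodule r F).1 hF)
      (fun j : Fin 2 => (MvPolynomial.C (m 0 j) * MvPolynomial.X 0 +
        MvPolynomial.C (m 1 j) * MvPolynomial.X 1 : Poly p)) (n := 1)
      (fun j => (MvPolynomial.isHomogeneous_C_mul_X _ _).add
        (MvPolynomial.isHomogeneous_C_mul_X _ _))
    rw [one_mul] at h
    rw [polyRep_apply]
    exact (MvPolynomial.mem_homogeneousSubmodule _ _).2 h

/-- The monomial `X^(r-i) Y^i`. -/
noncomputable def mono (p r i : ℕ) : Poly p :=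
  MvPolynomial.X 0 ^ (r - i) * MvPolynomial.X 1 ^ i

/-- `X_{r-i, r}`: the `𝔽_p[Γ]`-submodule generated by `X^(r-i) Y^i`, that is, the `𝔽_p`-span of
the orbit of this monomial under `Γ = GL₂(𝔽_p)`.  In particular `X_{n, n}` is `XSub p n 0`. -/
noncomputable def XSub (p r i : ℕ) : Submodule (ZMod p) (Poly p) :=
  Submodule.span (ZMod p)
    (Set.range fun γ : (Mat p)ˣ => polyRep p (γ : Mat p) (mono p r i))

theorem XSub_le_V (p r i : ℕ) (hi : i ≤ r) : XSub p r i ≤ (V p r).toSubmodule := by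
  refine Submodule.span_le.2 ?_
  rintro _ ⟨γ, rfl⟩
  refine (V p r).apply_mem_toSubmodule _ ?_
  have h := (MvPolynomial.isHomogeneous_X_pow (R := ZMod p) (0 : Fin 2) (r - i)).mul
    (MvPolynomial.isHomogeneous_X_pow (R := ZMod p) (1 : Fin 2) i)
  rw [Nat.sub_add_cancel hi] at h
  exact h

theorem smul_mem_XSub (p r i : ℕ) (γ : (Mat p)ˣ) {F : Poly p} (hF : F ∈ XSub p r i) :
    polyRep p (γ : Mat p) F ∈ XSub p r i := by
  have h : XSub p r i ≤ (XSub p r i).comap (polyRep p (γ : Mat p)) := by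
    rw [XSub, Submodule.span_le]
    rintro _ ⟨δ, rfl⟩
    rw [SetLike.mem_coe, Submodule.mem_comap, ← polyRep_mul]
    exact Submodule.subset_span ⟨γ * δ, by simp only [Units.val_mul]⟩
  exact Submodule.mem_comap.1 (h hF)

theorem polyRep_mono (p r i : ℕ) (m : Mat p) :
    polyRep p m (mono p r i) =
      (MvPolynomial.C (m 0 0) * MvPolynomial.X 0 + MvPolynomial.C (m 1 0) * MvPolynomial.X 1)
          ^ (r - i) *
        (MvPolynomial.C (m 0 1) * MvPolynomial.X 0 + MvPolynomial.C (m 1 1) * MvPolynomial.X 1)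
          ^ i := by
  simp [polyRep_apply, mono, subst]

/-- For `i ≤ p - 1` the module `X_{r-i, r}` contains the highest power `X^(r-i+i)`. -/
theorem X_pow_mem (p : ℕ) [Fact p.Prime] (r i : ℕ) (hi : i < p) :
    (MvPolynomial.X 0 ^ (r - i + i) : Poly p) ∈ XSub p r i := by
  have key : ∑ b : ZMod p, (b ^ (p - 1 - i)) • ((MvPolynomial.X 0 : Poly p) ^ (r - i) *
      (MvPolynomial.C b * MvPolynomial.X 0 + MvPolynomial.X 1) ^ i) ∈ XSub p r i := by
    refine Submodule.sum_mem _ fun b _ => Submodule.smul_mem _ _ ?_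
    have hdet : IsUnit (!![1, b; 0, 1] : Mat p) := by
      rw [Matrix.isUnit_iff_isUnit_det]
      simp [Matrix.det_fin_two]
    obtain ⟨γ, hγ⟩ := hdet
    refine Submodule.subset_span ⟨γ, ?_⟩
    simp only [hγ, polyRep_mono]
    simp
  have h2 : ∑ b : ZMod p, (b ^ (p - 1 - i)) • ((MvPolynomial.X 0 : Poly p) ^ (r - i) *
      (MvPolynomial.C b * MvPolynomial.X 0 + MvPolynomial.X 1) ^ i) =
      -(MvPolynomial.X 0 ^ (r - i + i)) := by
    have h3 : ∀ b : ZMod p, (b ^ (p - 1 - i)) • ((MvPolynomial.X 0 : Poly p) ^ (r - i) *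
      (MvPolynomial.C b * MvPolynomial.X 0 + MvPolynomial.X 1) ^ i) =
      ∑ l ∈ Finset.range (i + 1), MvPolynomial.C (b ^ (p - 1 - i + l)) *
        ((MvPolynomial.X 0 : Poly p) ^ (r - i) *
          (MvPolynomial.X 0 ^ l * MvPolynomial.X 1 ^ (i - l) * (i.choose l : Poly p))) := by
      intro b
      rw [add_pow, MvPolynomial.smul_eq_C_mul, Finset.mul_sum, Finset.mul_sum]
      refine Finset.sum_congr rfl fun l _ => ?_
      rw [mul_pow, pow_add, map_mul, map_pow, map_pow]
      ring
    simp_rw [h3]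
    rw [Finset.sum_comm]
    simp_rw [← Finset.sum_mul, ← map_sum]
    rw [Finset.sum_range_succ, Finset.sum_eq_zero]
    · have hs : ∑ b : ZMod p, b ^ (p - 1 - i + i) = -1 := by
        rw [Nat.sub_add_cancel (by omega)]
        have hp := (Fact.out : p.Prime).two_le
        rw [← Finset.sum_erase_add _ _ (Finset.mem_univ (0 : ZMod p)),
          zero_pow (by omega), add_zero]
        rw [Finset.sum_congr rfl (g := fun _ => (1 : ZMod p))
          (fun b hb => ZMod.pow_card_sub_one_eq_one (Finset.ne_of_mem_erase hb))]
        simp [ZMod.card, Nat.cast_sub (show 1 ≤ p by omega)]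
      rw [hs]
      simp [pow_add]
    · intro l hl
      have hl := Finset.mem_range.1 hl
      rw [FiniteField.sum_pow_lt_card_sub_one (ZMod p) _ (by rw [ZMod.card]; omega)]
      simp
  rw [h2] at key
  exact neg_mem_iff.1 key

/-- Every power of a linear form lies in `X_{r-i, r}` if `i ≤ p - 1`. -/
theorem linear_pow_mem (p : ℕ) [Fact p.Prime] (r i : ℕ) (hi : i < p) (x y : ZMod p)
    (hxy : x ≠ 0 ∨ y ≠ 0) :
    ((MvPolynomial.C x * MvPolynomial.X 0 + MvPolynomial.C y * MvPolynomial.X 1) ^ (r - i + i)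
      : Poly p) ∈ XSub p r i := by
  have hu : ∃ m : Mat p, IsUnit m ∧ m 0 0 = x ∧ m 1 0 = y := by
    rcases hxy with h | h
    · refine ⟨!![x, 0; y, 1], ?_, by simp, by simp⟩
      rw [Matrix.isUnit_iff_isUnit_det]
      simp [Matrix.det_fin_two, h]
    · refine ⟨!![x, 1; y, 0], ?_, by simp, by simp⟩
      rw [Matrix.isUnit_iff_isUnit_det]
      simp [Matrix.det_fin_two, h]
  obtain ⟨m, ⟨γ, rfl⟩, h0, h1⟩ := hu
  have h := smul_mem_XSub p r i γ (X_pow_mem p r i hi)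
  have e : polyRep p (γ : Mat p) (MvPolynomial.X 0 ^ (r - i + i)) =
      (MvPolynomial.C x * MvPolynomial.X 0 + MvPolynomial.C y * MvPolynomial.X 1)
        ^ (r - i + i) := by
    simp [polyRep_apply, subst, h0, h1]
  rwa [e] at h

/-- For `i ≤ p - 1` the `Γ`-module `X_{r-i, r}` is stable under all of `M`. -/
theorem XSub_stable (p : ℕ) [Fact p.Prime] (r i : ℕ) (hi : i < p) (m : Mat p) {F : Poly p}
    (hF : F ∈ XSub p r i) : polyRep p m F ∈ XSub p r i := by
  have hgen : ∀ m : Mat p, polyRep p m (mono p r i) ∈ XSub p r i := by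
    intro m
    by_cases hm : IsUnit m
    · obtain ⟨γ, rfl⟩ := hm
      exact Submodule.subset_span ⟨γ, rfl⟩
    · have hdet : m 0 0 * m 1 1 - m 0 1 * m 1 0 = 0 := by
        rw [Matrix.isUnit_iff_isUnit_det, isUnit_iff_ne_zero, not_not,
          Matrix.det_fin_two] at hm
        exact hm
      rw [polyRep_mono]
      have hlin : ∃ x y s t : ZMod p, (x ≠ 0 ∨ y ≠ 0) ∧ m 0 0 = s * x ∧ m 1 0 = s * y ∧
          m 0 1 = t * x ∧ m 1 1 = t * y := by
        by_cases h0 : m 0 0 = 0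
        · by_cases h1 : m 1 0 = 0
          · by_cases h2 : m 0 1 = 0 ∧ m 1 1 = 0
            · exact ⟨1, 0, 0, 0, by simp [h0, h1, h2.1, h2.2]⟩
            · refine ⟨m 0 1, m 1 1, 0, 1, ?_, by simp [h0], by simp [h1], by simp, by simp⟩
              tauto
          · refine ⟨m 0 0, m 1 0, 1, m 1 1 / m 1 0, Or.inr h1, by simp, by simp, ?_, ?_⟩
            · field_simp
              linear_combination -hdet
            · field_simp
        · refine ⟨m 0 0, m 1 0, 1, m 0 1 / m 0 0, Or.inl h0, by simp, by simp, ?_, ?_⟩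
          · field_simp
          · field_simp
            linear_combination hdet
      obtain ⟨x, y, s, t, hxy, e1, e2, e3, e4⟩ := hlin
      have h := Submodule.smul_mem _ (s ^ (r - i) * t ^ i) (linear_pow_mem p r i hi x y hxy)
      convert h using 1
      rw [e1, e2, e3, e4, MvPolynomial.smul_eq_C_mul]
      simp only [map_mul, map_pow]
      rw [mul_assoc, mul_assoc, mul_assoc, mul_assoc, ← mul_add, ← mul_add, mul_pow, mul_pow,
        pow_add]
      ring
  have h : XSub p r i ≤ (XSub p r i).comap (polyRep p m) := by
    rw [XSub, Submodule.span_le]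
    rintro _ ⟨δ, rfl⟩
    rw [SetLike.mem_coe, Submodule.mem_comap, ← polyRep_mul]
    exact hgen (m * δ)
  exact Submodule.mem_comap.1 (h hF)

/-- `X_{r-i, r}` with its `M`-module structure, for `i ≤ p - 1`. -/
noncomputable def X (p : ℕ) [Fact p.Prime] (r i : ℕ) (hi : i < p) :
    Subrepresentation (polyRep p) where
  toSubmodule := XSub p r i
  apply_mem_toSubmodule m _ hF := XSub_stable p r i hi m hF

/-- `X_{n, n}` with its `M`-module structure. -/
noncomputable def XTop (p : ℕ) [hp : Fact p.Prime] (n : ℕ) : Subrepresentation (polyRep p) :=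
  X p n 0 hp.out.pos

/-- `Σ_p(n)`: the sum of the digits of `n` in base `p`. -/
def digitSum (p n : ℕ) : ℕ := (Nat.digits p n).sum

end MonomialModules

/-!
Multiplication of polynomials is an `M`-equivariant map `X_{r-i, r-i} ⊗ V_i → V_r` with image
`X_{r-i, r}` (`XSub_mul_V`): the monomials `X^(r-j) Y^j` with `j ≤ i < p` all lie in `X_{r-i, r}`,
as is seen by summing the unipotent translates of `X^(r-j-1) Y^(j+1)` with suitable weights. So
everything depends on when this map is injective.

Put `n = r - i`, `k = r₀ - i` and `n = k + pu`. In `(aX + cY)^n` the functions `a^(n-e) c^e` of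
`a, c ∈ 𝔽_p` depend only on digit sums, and this bounds the dimension of `X_{n, n}` by `Σ_p(n) + 1`;
the number of points of the projective line bounds it by `p + 1`. After dehomogenizing, an element
of the kernel is a relation `∑ (x + b)^n g_b = 0` with `deg g_b ≤ i`, perhaps with a further term
for the point at infinity. Since `(x + b)^n = (x + b)^k (x^p + b)^u`, comparing coefficients over
`𝔽_p[x^p]` and using Lucas's theorem gives `∑ b^m (x + b)^k g_b = 0` for `m ≤ Σ_p(u)` (for
`m < Σ_p(u)` if the point at infinity occurs, which it need not unless `p ≤ Σ_p(n)`), hence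
`∑ (x + b)^m g_b = 0` for a range of at least `i + 1` consecutive exponents `m < p`, provided that
`i ≤ Σ_p(u)`, that is, `r₀ ≤ Σ_p(r - i)`. A derivative argument (`sum_pow_mul_eq_zero_of_le`)
extends this to all smaller `m`, and then a Vandermonde argument yields `g_b = 0`. With `i = 0` the
same computation shows that `X_{n, n}` has a basis of `min(Σ_p(n), p) + 1` powers of linear forms.

If `Σ_p(r - i) < r₀`, then `s = Σ_p(r - r₀) < i`, and
`X_{r-s, r} ≤ X_{r-i, r} ≤ V_{r₀} X_{r-r₀, r-r₀}`. The injectivity for `s` in place of `i` shows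
that the first of these spaces has dimension `(r₀ + 1)(s + 1)`, which bounds that of the last. So
`X_{r-i, r} = X_{r-s, r}` (`XSub_eq_of_digitSum_le`), and the result for `s` applies.
-/

namespace MonomialModules

section

open Polynomial Nat

/-! ### Base `p` digit sums and binomial coefficients modulo `p` -/

theorem digitSum_add_mul (p a u : ℕ) (ha : a < p) (hp : 1 < p) :
    digitSum p (a + p * u) = a + digitSum p u := by
  rcases Nat.eq_zero_or_pos (a + p * u) with h | h
  · have h1 : a = 0 := by omega
    have h2 : u = 0 := by
      rcases Nat.eq_zero_or_pos u with h' | h'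
      · exact h'
      · have := Nat.mul_pos (show 0 < p by omega) h'
        omega
    subst h1 h2
    simp [digitSum]
  · unfold digitSum
    rw [Nat.digits_eq_cons_digits_div hp h.ne', List.sum_cons, Nat.add_mul_mod_self_left,
      Nat.mod_eq_of_lt ha, Nat.add_mul_div_left _ _ (by omega), Nat.div_eq_of_lt ha, zero_add]

theorem digitSum_eq (p n : ℕ) (hp : 1 < p) :
    digitSum p n = n % p + digitSum p (n / p) := by
  conv_lhs => rw [← Nat.mod_add_div n p]
  exact digitSum_add_mul p _ _ (Nat.mod_lt _ (by omega)) hp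

theorem digitSum_of_lt (p n : ℕ) (hp : 1 < p) (hn : n < p) : digitSum p n = n := by
  simpa [digitSum] using digitSum_add_mul p n 0 hn hp

/-- Raising to the power `e` on `𝔽_p` depends only on the digit sum of `e`, since `b ^ p = b`. -/
theorem pow_digitSum (p : ℕ) [hp : Fact p.Prime] (b : ZMod p) (e : ℕ) :
    b ^ digitSum p e = b ^ e := by
  induction e using Nat.strong_induction_on with
  | _ e ih =>
    rcases Nat.lt_or_ge e p with h | h
    · rw [digitSum_of_lt p e hp.out.one_lt h]
    · have h1 := ih (e / p) (Nat.div_lt_self (by have := hp.out.pos; omega) hp.out.one_lt)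
      rw [digitSum_eq p e hp.out.one_lt, pow_add, h1]
      conv_rhs => rw [← Nat.mod_add_div e p, pow_add, pow_mul, ZMod.pow_card]

/-- By Lucas, the exponents `e` with `u.choose e ≢ 0` are those whose digits are bounded by the
digits of `u`; their digit sums exhaust `0, …, Σ_p(u)`. -/
theorem exists_choose_ne_zero (p : ℕ) [hp : Fact p.Prime] (u m : ℕ) (hm : m ≤ digitSum p u) :
    ∃ e, (u.choose e : ZMod p) ≠ 0 ∧ digitSum p e = m := by
  induction u using Nat.strong_induction_on generalizing m with
  | _ u ih =>
    have hp1 := hp.out.one_lt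
    rcases Nat.eq_zero_or_pos u with rfl | hu
    · have : m = 0 := by simpa [digitSum] using hm
      exact ⟨0, by simp, by simp [digitSum, this]⟩
    · have hmod := Nat.mod_lt u hp.out.pos
      rw [digitSum_eq p u hp1] at hm
      obtain ⟨e', he', hs⟩ := ih (u / p) (Nat.div_lt_self hu hp1) (m - min (u % p) m) (by omega)
      refine ⟨min (u % p) m + p * e', ?_, ?_⟩
      · have h := (ZMod.natCast_eq_natCast_iff _ _ p).2
          (Choose.choose_modEq_choose_mod_mul_choose_div_nat (n := u)
            (k := min (u % p) m + p * e') (p := p))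
        have hlt : min (u % p) m < p := by omega
        rw [Nat.add_mul_mod_self_left, Nat.mod_eq_of_lt hlt,
          Nat.add_mul_div_left _ _ hp.out.pos, Nat.div_eq_of_lt hlt, zero_add] at h
        rw [h, Nat.cast_mul]
        refine mul_ne_zero ?_ he'
        rw [Ne, ZMod.natCast_eq_zero_iff]
        intro hd
        have hfac := hd.mul_right ((min (u % p) m)! * (u % p - min (u % p) m)!)
        rw [← mul_assoc, Nat.choose_mul_factorial_mul_factorial (Nat.min_le_left _ _),
          hp.out.dvd_factorial] at hfac
        omega
      · rw [digitSum_add_mul p _ _ (by omega) hp1, hs]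
        omega

theorem digitSum_add_of_choose_ne_zero (p : ℕ) [hp : Fact p.Prime] (n e : ℕ)
    (h : (n.choose e : ZMod p) ≠ 0) :
    digitSum p e + digitSum p (n - e) = digitSum p n := by
  have hen : e ≤ n := by
    by_contra hlt
    exact h (by rw [Nat.choose_eq_zero_of_lt (by omega), Nat.cast_zero])
  -- Legendre: `(p - 1) v_p(n!) = n - Σ_p(n)`, applied to `n.choose e * e! * (n - e)! = n!`.
  have hv := congrArg (padicValNat p) (Nat.choose_mul_factorial_mul_factorial hen)
  rw [padicValNat.mul (mul_ne_zero (Nat.choose_pos hen).ne' e.factorial_ne_zero)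
      (Nat.factorial_ne_zero _),
    padicValNat.mul (Nat.choose_pos hen).ne' e.factorial_ne_zero,
    padicValNat.eq_zero_of_not_dvd (fun hd => h ((ZMod.natCast_eq_zero_iff _ _).2 hd)),
    zero_add] at hv
  have hv' := congrArg (fun t => (p - 1) * t) hv
  simp only [mul_add, sub_one_mul_padicValNat_factorial] at hv'
  have h1 := Nat.digit_sum_le p e
  have h2 := Nat.digit_sum_le p (n - e)
  have h3 := Nat.digit_sum_le p n
  unfold digitSum
  omega

/-! ### Vanishing of combinations of powers of linear polynomials -/

section Univariate

variable {F : Type*} [Field F]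

/-- Put `A_m(g) = ∑ (x + b) ^ m g_b`. Then `A_m(g)' = m A_{m-1}(g) + A_m(g')`. So the hypothesis
for `g` gives that for `g'` on a range of exponents shorter by one, by induction `A_m(g') = 0` for
all `m ≤ N`, and the identity becomes a descent from `A_m(g) = 0` to `A_{m-1}(g) = 0`. -/
theorem sum_pow_mul_eq_zero_of_le (T : Finset F) (d : ℕ) (k N : ℕ)
    (hN : ∀ m, 0 < m → m ≤ N → (m : F) ≠ 0) (hd : k + d ≤ N + 1) (g : F → F[X])
    (hg : ∀ b ∈ T, derivative^[d] (g b) = 0)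
    (h : ∀ m, k ≤ m → m ≤ N → ∑ b ∈ T, (Polynomial.X + C b) ^ m * g b = 0) :
    ∀ m ≤ N, ∑ b ∈ T, (Polynomial.X + C b) ^ m * g b = 0 := by
  induction d generalizing k g with
  | zero =>
    intro m _
    exact Finset.sum_eq_zero fun b hb => by
      rw [show g b = 0 from hg b hb, mul_zero]
  | succ d ih =>
    have hder : ∀ m : ℕ, derivative (∑ b ∈ T, (Polynomial.X + C b) ^ m * g b) =
        (m : F[X]) * ∑ b ∈ T, (Polynomial.X + C b) ^ (m - 1) * g b +
          ∑ b ∈ T, (Polynomial.X + C b) ^ m * derivative (g b) := by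
      intro m
      rw [derivative_sum, Finset.mul_sum, ← Finset.sum_add_distrib]
      refine Finset.sum_congr rfl fun b _ => ?_
      rw [derivative_mul, derivative_X_add_C_pow]
      simp [mul_assoc]
    have hz := ih (k + 1) (by omega) (fun b => derivative (g b))
      (fun b hb => by simpa using hg b hb) (fun m hm hmN => by
        have h1 := hder m
        rw [h m (by omega) hmN, h (m - 1) (by omega) (by omega)] at h1
        simpa using h1.symm)
    have hdown : ∀ j m, m ≤ N → k ≤ m + j → ∑ b ∈ T, (Polynomial.X + C b) ^ m * g b = 0 := by
      intro j
      induction j with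
      | zero => exact fun m hm hk => h m hk hm
      | succ j ihj =>
        intro m hm hk
        rcases Nat.lt_or_ge m k with hmk | hmk
        · have h1 := hder (m + 1)
          rw [ihj (m + 1) (by omega) (by omega), hz (m + 1) (by omega)] at h1
          have h2 : ((m + 1 : ℕ) : F[X]) ≠ 0 := by
            rw [← C_eq_natCast, Ne, C_eq_zero]
            exact hN _ (by omega) (by omega)
          rw [map_zero, add_zero, Nat.add_sub_cancel] at h1
          exact (mul_eq_zero.1 h1.symm).resolve_left h2
        · exact h m hmk hm
    exact fun m hm => hdown k m hm (by omega)

/-- The Vandermonde argument with nodes `x + b` in the domain `F[x]`. -/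
theorem eq_zero_of_sum_pow_mul_eq_zero (T : Finset F) (N : ℕ) (hT : T.card ≤ N + 1)
    (g : F → F[X]) (h : ∀ m ≤ N, ∑ b ∈ T, (Polynomial.X + C b) ^ m * g b = 0) :
    ∀ b ∈ T, g b = 0 := by
  classical
  intro b hb
  have hq : ∀ q : F[X][X], q.natDegree ≤ N → ∑ c ∈ T, q.eval (Polynomial.X + C c) * g c = 0 := by
    intro q hq
    simp_rw [eval_eq_sum_range' (Nat.lt_succ_of_le hq), Finset.sum_mul]
    rw [Finset.sum_comm]
    refine Finset.sum_eq_zero fun m hm => ?_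
    simp_rw [mul_assoc]
    rw [← Finset.mul_sum, h m (by simpa [Nat.lt_succ_iff] using hm), mul_zero]
  have h1 := hq (∏ c ∈ T.erase b, (Polynomial.X - C (Polynomial.X + C c))) (by
    rw [natDegree_prod_of_monic _ _ fun c _ => monic_X_sub_C _]
    simp_rw [natDegree_X_sub_C]
    rw [Finset.sum_const, Finset.card_erase_of_mem hb, smul_eq_mul, mul_one]
    omega)
  rw [Finset.sum_eq_single_of_mem b hb] at h1
  · refine (mul_eq_zero.1 h1).resolve_left ?_
    rw [eval_prod]
    refine Finset.prod_ne_zero_iff.2 fun c hc => ?_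
    have hbc : b - c ≠ 0 := sub_ne_zero.2 (Finset.ne_of_mem_erase hc).symm
    rw [eval_sub, eval_X, eval_C, add_sub_add_left_eq_sub, ← C_sub]
    exact C_ne_zero.2 hbc
  · intro c hc hcb
    rw [eval_prod, Finset.prod_eq_zero (Finset.mem_erase.2 ⟨hcb, hc⟩) (by simp), zero_mul]

/-- Coordinates of `f(x) q(x ^ p)` in the basis `1, x, …, x ^ (p - 1)` of `F[x]` over `F[x ^ p]`. -/
theorem coeff_mul_expand (p : ℕ) (f q : F[X]) (hf : f.natDegree < p) (j l : ℕ) (hj : j < p) :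
    (f * expand F p q).coeff (j + p * l) = f.coeff j * q.coeff l := by
  have hp : 0 < p := by omega
  rw [coeff_mul, Finset.sum_eq_single (j, p * l)]
  · rw [mul_comm p l, coeff_expand_mul hp]
  · rintro ⟨a, c⟩ hac hne
    replace hac := Finset.HasAntidiagonal.mem_antidiagonal.1 hac
    simp only at hac ⊢
    rw [coeff_expand hp]
    split_ifs with hd
    · obtain ⟨t, rfl⟩ := hd
      rcases Nat.lt_or_ge a p with ha | ha
      · exfalso
        have e1 : (a + p * t) % p = (j + p * l) % p := by rw [hac]
        rw [Nat.add_mul_mod_self_left, Nat.add_mul_mod_self_left, Nat.mod_eq_of_lt ha,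
          Nat.mod_eq_of_lt hj] at e1
        exact hne (Prod.ext e1 (by simp only; omega))
      · rw [coeff_eq_zero_of_natDegree_lt (by omega), zero_mul]
    · rw [mul_zero]
  · intro h
    simp at h

end Univariate

/-- Write `(x + b) ^ (k + pu) = (x + b) ^ k (x ^ p + b) ^ u` and compare coefficients with respect
to the basis `1, x, …, x ^ (p - 1)` over `𝔽_p[x ^ p]`. The coefficient of `x ^ (p (u - e))` in
`(x ^ p + b) ^ u` is `u.choose e * b ^ Σ_p(e)`. The extra term `g'` has degree less than `p`, so it
only meets the coefficients with `e = u`, that is, with `Σ_p(e) = Σ_p(u)`. -/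
theorem sum_C_pow_mul_eq_zero (p : ℕ) [hp : Fact p.Prime] (k u : ℕ) (T : Finset (ZMod p))
    (g : ZMod p → (ZMod p)[X]) (hg : ∀ b ∈ T, k + (g b).natDegree < p) (g' : (ZMod p)[X])
    (hg' : g'.natDegree < p)
    (h : ∑ b ∈ T, (Polynomial.X + C b) ^ (k + p * u) * g b + g' = 0) (m : ℕ) (hm : m ≤ digitSum p u)
    (hm' : g' = 0 ∨ m < digitSum p u) :
    ∑ b ∈ T, C (b ^ m) * ((Polynomial.X + C b) ^ k * g b) = 0 := by
  obtain ⟨e, he, hes⟩ := exists_choose_ne_zero p u m hm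
  have heu : e ≤ u := by
    by_contra hlt
    exact he (by rw [Nat.choose_eq_zero_of_lt (by omega), Nat.cast_zero])
  have hdeg : ∀ b ∈ T, ((Polynomial.X + C b) ^ k * g b).natDegree < p := fun b hb =>
    (natDegree_mul_le.trans (by simp)).trans_lt (hg b hb)
  ext j
  rw [coeff_zero, finsetSum_coeff]
  rcases Nat.lt_or_ge j p with hj | hj
  · have h1 := congrArg (fun f => coeff f (j + p * (u - e))) h
    have hg0 : g'.coeff (j + p * (u - e)) = 0 := by
      rcases hm' with h0 | h0
      · rw [h0, coeff_zero]
      · refine coeff_eq_zero_of_natDegree_lt (hg'.trans_le ?_)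
        have hlt : e ≠ u := by rintro rfl; omega
        have := Nat.mul_le_mul_left p (show 1 ≤ u - e by omega)
        omega
    simp only [coeff_add, hg0, finsetSum_coeff, coeff_zero, add_zero] at h1
    have h2 : ∀ b ∈ T, ((Polynomial.X + C b) ^ (k + p * u) * g b).coeff (j + p * (u - e)) =
        (u.choose e : ZMod p) * (C (b ^ m) * ((Polynomial.X + C b) ^ k * g b)).coeff j := by
      intro b hb
      have h3 : (Polynomial.X + C b) ^ (k + p * u) * g b =
          (Polynomial.X + C b) ^ k * g b * expand (ZMod p) p ((Polynomial.X + C b) ^ u) := by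
        rw [map_pow, map_add, expand_X, expand_C, pow_add, pow_mul,
          add_pow_char _ _ p, ← C_pow, ZMod.pow_card]
        ring
      rw [h3, coeff_mul_expand p _ _ (hdeg b hb) _ _ hj, coeff_X_add_C_pow, coeff_C_mul,
        Nat.sub_sub_self heu, Nat.choose_symm heu, ← pow_digitSum p b e, hes]
      ring
    rw [Finset.sum_congr rfl h2, ← Finset.mul_sum] at h1
    exact (mul_eq_zero.1 h1).resolve_left he
  · refine Finset.sum_eq_zero fun b hb => ?_
    rw [coeff_C_mul, coeff_eq_zero_of_natDegree_lt ((hdeg b hb).trans_le hj), mul_zero]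

/-- The univariate form of the injectivity of `X_{n, n} ⊗ V_i → V_{n + i}`; `g'` is the coefficient
at the point at infinity. -/
theorem eq_zero_of_sum_pow_mul_add_eq_zero (p : ℕ) [hp : Fact p.Prime] (n i : ℕ)
    (hi : n % p + i < p) (hS : n % p + i ≤ digitSum p n) (T : Finset (ZMod p))
    (hT : T.card ≤ digitSum p n + 1)
    (g : ZMod p → (ZMod p)[X]) (hg : ∀ b ∈ T, (g b).natDegree ≤ i) (g' : (ZMod p)[X])
    (hg' : g'.natDegree ≤ i) (h0 : g' = 0 ∨ p ≤ digitSum p n)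
    (h : ∑ b ∈ T, (Polynomial.X + C b) ^ n * g b + g' = 0) : (∀ b ∈ T, g b = 0) ∧ g' = 0 := by
  have hsum := digitSum_eq p n hp.out.one_lt
  set k := n % p with hk
  set N := min (digitSum p n) (p - 1) with hN
  -- If `g'` is present then `p ≤ Σ_p(n)`, and `m ≤ p - 1 - k` stays below `Σ_p(n / p)`.
  have hrel : ∀ m ≤ N - k, ∑ b ∈ T, C (b ^ m) * ((Polynomial.X + C b) ^ k * g b) = 0 := by
    intro m hm
    refine sum_C_pow_mul_eq_zero p k (n / p) T g (fun b hb => ?_) g' (by omega) ?_ m (by omega) ?_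
    · have := hg b hb
      omega
    · rwa [hk, Nat.mod_add_div]
    · exact h0.imp_right fun h0 => by omega
  -- Expanding `(x + b) ^ (m - k)` in powers of `b` turns these relations into
  -- `∑ (x + b) ^ m g_b = 0` for `k ≤ m ≤ N`.
  have hpow : ∀ m, k ≤ m → m ≤ N → ∑ b ∈ T, (Polynomial.X + C b) ^ m * g b = 0 := by
    intro m hkm hmN
    have e : ∀ b ∈ T, (Polynomial.X + C b) ^ m * g b = ∑ j ∈ Finset.range (m - k + 1),
        Polynomial.X ^ (m - k - j) * ((m - k).choose j : (ZMod p)[X]) *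
          (C (b ^ j) * ((Polynomial.X + C b) ^ k * g b)) := by
      intro b _
      obtain ⟨t, rfl⟩ := Nat.exists_eq_add_of_le hkm
      rw [Nat.add_sub_cancel_left, pow_add, add_comm Polynomial.X (C b),
        add_pow (C b) Polynomial.X t, Finset.mul_sum, Finset.sum_mul]
      refine Finset.sum_congr rfl fun j _ => ?_
      rw [C_pow]
      ring
    rw [Finset.sum_congr rfl e, Finset.sum_comm]
    refine Finset.sum_eq_zero fun j hj => ?_
    rw [Finset.mem_range] at hj
    rw [← Finset.mul_sum, hrel j (by omega), mul_zero]
  have hall := sum_pow_mul_eq_zero_of_le T (i + 1) k N (fun m hm hmN h => by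
      have := Nat.le_of_dvd hm ((ZMod.natCast_eq_zero_iff _ _).1 h)
      omega) (by omega) g
    (fun b hb => iterate_derivative_eq_zero (Nat.lt_succ_of_le (hg b hb))) hpow
  have hcard : T.card ≤ p := by simpa [ZMod.card] using Finset.card_le_univ T
  have hz := eq_zero_of_sum_pow_mul_eq_zero T N (by omega) g hall
  refine ⟨hz, ?_⟩
  rwa [Finset.sum_eq_zero (fun b hb => by rw [hz b hb, mul_zero]), zero_add] at h

end

/-! ### Dehomogenization and the spaces `V_i` -/

/-- A homogeneous form in two variables is determined by its dehomogenization `X ↦ x, Y ↦ 1`. -/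
theorem eq_zero_of_aeval_eq_zero {R : Type*} [CommRing R] {i : ℕ} {F : MvPolynomial (Fin 2) R}
    (hF : F.IsHomogeneous i) (h : MvPolynomial.aeval ![Polynomial.X, (1 : Polynomial R)] F = 0) :
    F = 0 := by
  rw [← Polynomial.homogenize_eq_of_isHomogeneous hF h, Polynomial.homogenize_zero]

theorem natDegree_aeval_le {R : Type*} [CommRing R] {i : ℕ} {F : MvPolynomial (Fin 2) R}
    (hF : F.IsHomogeneous i) :
    (MvPolynomial.aeval ![Polynomial.X, (1 : Polynomial R)] F).natDegree ≤ i := by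
  have h := MvPolynomial.aeval_natDegree_le (n := 1) F hF.totalDegree_le
    (![Polynomial.X, (1 : Polynomial R)]) (fun j => by
      fin_cases j
      · exact Polynomial.natDegree_X_le
      · simp)
  simpa using h

/-- Homogenization identifies the univariate polynomials of degree at most `i` with `V_i`. -/
noncomputable def degreeLTEquivV (p i : ℕ) :
    Polynomial.degreeLT (ZMod p) (i + 1) ≃ₗ[ZMod p] (V p i).toSubmodule :=
  LinearEquiv.ofBijective
    (((Polynomial.homogenizeLM i).domRestrict _).codRestrict _ fun q =>
      Polynomial.isHomogeneous_homogenize q.1) <| by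
    constructor
    · rw [← LinearMap.ker_eq_bot, LinearMap.ker_eq_bot']
      rintro ⟨q, hq⟩ h
      have hq' : q.natDegree ≤ i :=
        Polynomial.natDegree_le_iff_coeff_eq_zero.2 fun m hm =>
          (Polynomial.degree_lt_iff_coeff_zero _ _).1 (Polynomial.mem_degreeLT.1 hq) m hm
      exact Subtype.ext (Polynomial.eq_zero_of_homogenize_eq_zero hq' (congrArg Subtype.val h))
    · rintro ⟨F, hF⟩
      have hF' : F.IsHomogeneous i := hF
      refine ⟨⟨MvPolynomial.aeval ![Polynomial.X, 1] F, ?_⟩, Subtype.ext ?_⟩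
      · rw [Polynomial.mem_degreeLT]
        refine Polynomial.degree_le_natDegree.trans_lt ?_
        exact_mod_cast Nat.lt_succ_of_le (natDegree_aeval_le hF')
      · exact Polynomial.homogenize_eq_of_isHomogeneous hF' rfl

instance (p i : ℕ) [Fact p.Prime] : Module.Finite (ZMod p) (V p i).toSubmodule :=
  Module.Finite.equiv ((Polynomial.degreeLTEquiv (ZMod p) (i + 1)).symm ≪≫ₗ degreeLTEquivV p i)

theorem finrank_V (p i : ℕ) [Fact p.Prime] :
    Module.finrank (ZMod p) (V p i).toSubmodule = i + 1 := by
  rw [← ((Polynomial.degreeLTEquiv (ZMod p) (i + 1)).symm ≪≫ₗ degreeLTEquivV p i).finrank_eq]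
  simp

theorem finite_XSub (p r i : ℕ) [Fact p.Prime] (hi : i ≤ r) :
    Module.Finite (ZMod p) (XSub p r i) :=
  Module.Finite.of_injective (Submodule.inclusion (XSub_le_V p r i hi))
    (Submodule.inclusion_injective _)

/-! ### Powers of linear forms -/

/-- Representatives of the points of the projective line over `𝔽_p`, as linear forms: `Y` for the
point at infinity `none`, and `X + bY` for `some b`. -/
noncomputable def linForm (p : ℕ) : Option (ZMod p) → Poly p
  | none => MvPolynomial.X 1
  | some b => MvPolynomial.X 0 + MvPolynomial.C b * MvPolynomial.X 1

theorem linForm_pow_mem (p : ℕ) [hp : Fact p.Prime] (n : ℕ) (t : Option (ZMod p)) :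
    linForm p t ^ n ∈ XSub p n 0 := by
  cases t with
  | none => simpa [linForm] using linear_pow_mem p n 0 hp.out.pos 0 1 (by simp)
  | some b => simpa [linForm] using linear_pow_mem p n 0 hp.out.pos 1 b (by simp)

theorem polyRep_mono_zero (p n : ℕ) (m : Mat p) :
    polyRep p m (mono p n 0) = (MvPolynomial.C (m 0 0) * MvPolynomial.X 0 +
      MvPolynomial.C (m 1 0) * MvPolynomial.X 1) ^ n := by
  simp [polyRep_mono]

theorem XSub_le_span_linForm (p : ℕ) [Fact p.Prime] (n : ℕ) :
    XSub p n 0 ≤ Submodule.span (ZMod p) (Set.range fun t => linForm p t ^ n) := by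
  refine Submodule.span_le.2 ?_
  rintro _ ⟨γ, rfl⟩
  simp only [polyRep_mono_zero, SetLike.mem_coe]
  generalize (γ : Mat p) 0 0 = a
  generalize (γ : Mat p) 1 0 = c
  by_cases ha : a = 0
  · have h := Submodule.smul_mem _ (c ^ n) (Submodule.subset_span (R := ZMod p)
      (Set.mem_range_self (f := fun t => linForm p t ^ n) none))
    convert h using 1
    simp [ha, linForm, MvPolynomial.smul_eq_C_mul, mul_pow]
  · have h := Submodule.smul_mem _ (a ^ n) (Submodule.subset_span (R := ZMod p)
      (Set.mem_range_self (f := fun t => linForm p t ^ n) (some (c / a))))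
    convert h using 1
    simp only [linForm, MvPolynomial.smul_eq_C_mul, map_pow]
    rw [← mul_pow, mul_add, ← mul_assoc, ← map_mul, mul_div_cancel₀ c ha]

/-- The coefficient of `a ^ (Σ_p(n) - m) c ^ m` in `(aX + cY) ^ n`, when powers of `a, c ∈ 𝔽_p` are
reduced by `a ^ p = a`. -/
noncomputable def powCoeff (p n m : ℕ) : Poly p :=
  ∑ e ∈ Finset.range (n + 1), if digitSum p e = m then
    MvPolynomial.C (n.choose e : ZMod p) * (MvPolynomial.X 1 ^ e * MvPolynomial.X 0 ^ (n - e))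
    else 0

theorem linear_pow_eq_sum_powCoeff (p : ℕ) [Fact p.Prime] (n : ℕ) (a c : ZMod p) :
    ((MvPolynomial.C a * MvPolynomial.X 0 + MvPolynomial.C c * MvPolynomial.X 1) ^ n : Poly p) =
      ∑ m : Fin (digitSum p n + 1), (a ^ (digitSum p n - m) * c ^ (m : ℕ)) •
        powCoeff p n m := by
  rw [Fin.sum_univ_eq_sum_range
    (fun m => (a ^ (digitSum p n - m) * c ^ m) • powCoeff p n m) (digitSum p n + 1)]
  simp_rw [powCoeff, Finset.smul_sum]
  rw [Finset.sum_comm, add_comm, add_pow]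
  refine Finset.sum_congr rfl fun e _ => ?_
  simp_rw [smul_ite, smul_zero]
  rw [Finset.sum_ite_eq]
  by_cases h : (n.choose e : ZMod p) = 0
  · have h' : (n.choose e : Poly p) = 0 := by
      rw [← map_natCast (MvPolynomial.C (R := ZMod p) (σ := Fin 2)), h, map_zero]
    simp [h, h']
  · have hs := digitSum_add_of_choose_ne_zero p n e h
    rw [if_pos (Finset.mem_range.2 (by omega)), ← hs, Nat.add_sub_cancel_left, pow_digitSum,
      pow_digitSum, MvPolynomial.smul_eq_C_mul, map_mul, map_pow, map_pow, map_natCast, mul_pow,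
      mul_pow]
    ring

theorem finrank_XSub_le_digitSum (p : ℕ) [Fact p.Prime] (n : ℕ) :
    Module.finrank (ZMod p) (XSub p n 0) ≤ digitSum p n + 1 := by
  have hle : XSub p n 0 ≤ Submodule.span (ZMod p)
      (Set.range fun m : Fin (digitSum p n + 1) => powCoeff p n m) := by
    refine Submodule.span_le.2 ?_
    rintro _ ⟨γ, rfl⟩
    simp only [polyRep_mono_zero, linear_pow_eq_sum_powCoeff, SetLike.mem_coe]
    exact Submodule.sum_mem _ fun m _ =>
      Submodule.smul_mem _ _ (Submodule.subset_span (Set.mem_range_self m))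
  have := Module.Finite.span_of_finite (ZMod p)
    (Set.finite_range fun m : Fin (digitSum p n + 1) => powCoeff p n m)
  refine (Submodule.finrank_mono hle).trans ?_
  simpa [Set.finrank] using finrank_range_le_card (R := ZMod p)
    (fun m : Fin (digitSum p n + 1) => powCoeff p n m)

theorem finrank_XSub_le_card (p : ℕ) [Fact p.Prime] (n : ℕ) :
    Module.finrank (ZMod p) (XSub p n 0) ≤ p + 1 := by
  have := Module.Finite.span_of_finite (ZMod p)
    (Set.finite_range fun t => linForm p t ^ n)
  refine (Submodule.finrank_mono (XSub_le_span_linForm p n)).trans ?_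
  simpa [Set.finrank, ZMod.card] using finrank_range_le_card (R := ZMod p)
    (fun t => linForm p t ^ n)

/-- Powers `L ^ n` of pairwise independent linear forms satisfy no relation with coefficients in
`V_i`, provided there are at most `Σ_p(n) + 1` of them. For `Σ_p(n) < p` it is enough to use affine
points, so the point at infinity is admitted only when `p ≤ Σ_p(n)`. -/
theorem eq_zero_of_sum_linForm_pow_mul_eq_zero (p : ℕ) [hp : Fact p.Prime] (n i : ℕ)
    (hi : n % p + i < p) (hS : n % p + i ≤ digitSum p n) (U : Finset (Option (ZMod p)))
    (hU : U.card ≤ digitSum p n + 1) (hU' : none ∈ U → p ≤ digitSum p n)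
    (G : U → Poly p) (hG : ∀ t : U, (G t).IsHomogeneous i)
    (h : ∑ t : U, linForm p t ^ n * G t = 0) (t : U) : G t = 0 := by
  classical
  set φ := MvPolynomial.aeval (R := ZMod p) ![Polynomial.X, (1 : Polynomial (ZMod p))] with hφ
  let g : Option (ZMod p) → Polynomial (ZMod p) := fun t => if ht : t ∈ U then φ (G ⟨t, ht⟩) else 0
  have hgG : ∀ t : U, g t = φ (G t) := fun t => dif_pos t.2
  have hgi : ∀ t, (g t).natDegree ≤ i := by
    intro t
    by_cases ht : t ∈ U
    · rw [hgG ⟨t, ht⟩]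
      exact natDegree_aeval_le (hG _)
    · simp [g, ht]
  have h1 : ∑ t ∈ U, φ (linForm p t ^ n) * g t = 0 := by
    rw [← Finset.sum_coe_sort]
    simp_rw [hgG, ← map_mul]
    rw [← map_sum, h, map_zero]
  have h2 : ∑ t, φ (linForm p t ^ n) * g t = 0 := by
    rw [← h1]
    refine (Finset.sum_subset (Finset.subset_univ U) fun t _ ht => ?_).symm
    simp [g, ht]
  rw [Fintype.sum_option, add_comm] at h2
  have h3 : ∑ b ∈ Finset.univ.filter (fun b => some b ∈ U),
      (Polynomial.X + Polynomial.C b) ^ n * g (some b) + g none = 0 := by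
    rw [← h2]
    congr 1
    · rw [Finset.sum_filter]
      refine Finset.sum_congr rfl fun b _ => ?_
      split_ifs with hb
      · simp [hφ, linForm]
      · simp [g, hb]
    · simp [hφ, linForm]
  obtain ⟨h4, h5⟩ := eq_zero_of_sum_pow_mul_add_eq_zero p n i hi hS _
    ((Finset.card_le_card_of_injOn some (fun b hb => by simpa using hb)
      (Option.some_injective _).injOn).trans hU) (fun b => g (some b)) (fun b _ => hgi _) _
    (hgi none) (by
      by_cases hn : none ∈ U
      · exact Or.inr (hU' hn)
      · exact Or.inl (by simp [g, hn])) h3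
  -- Dehomogenization loses nothing, so it suffices that the dehomogenized coefficient vanishes.
  refine eq_zero_of_aeval_eq_zero (hG t) ?_
  rw [← hφ, ← hgG]
  obtain ⟨t | b, ht⟩ := t
  · exact h5
  · exact h4 b (by simpa using ht)

/-- A basis of `X_{n, n}` consisting of powers of linear forms, to which
`eq_zero_of_sum_linForm_pow_mul_eq_zero` applies. -/
theorem exists_basis_linForm_pow (p : ℕ) [hp : Fact p.Prime] (n : ℕ) :
    ∃ U : Finset (Option (ZMod p)), U.card = min (digitSum p n) p + 1 ∧
      (none ∈ U → p ≤ digitSum p n) ∧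
      ∃ B : Module.Basis U (ZMod p) (XSub p n 0), ∀ t, (B t : Poly p) = linForm p t ^ n := by
  have hU : ∃ U : Finset (Option (ZMod p)), U.card = min (digitSum p n) p + 1 ∧
      (none ∈ U → p ≤ digitSum p n) := by
    rcases Nat.lt_or_ge (digitSum p n) p with h | h
    · obtain ⟨T, -, hT⟩ := Finset.exists_subset_card_eq (s := (Finset.univ : Finset (ZMod p)))
        (n := digitSum p n + 1) (by simpa [ZMod.card] using h)
      exact ⟨T.map ⟨some, Option.some_injective _⟩, by simp [hT, h.le], by simp⟩
    · exact ⟨Finset.univ, by simp [ZMod.card, h], fun _ => h⟩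
  obtain ⟨U, hc, hn⟩ := hU
  have hlast := digitSum_eq p n hp.out.one_lt
  have hli : LinearIndependent (ZMod p)
      (fun t : U => (⟨linForm p t ^ n, linForm_pow_mem p n t⟩ : XSub p n 0)) := by
    rw [Fintype.linearIndependent_iff]
    intro c hc' t
    have h := eq_zero_of_sum_linForm_pow_mul_eq_zero p n 0 (Nat.mod_lt _ hp.out.pos) (by omega) U
      (by omega) hn (fun t => MvPolynomial.C (c t)) (fun t => MvPolynomial.isHomogeneous_C _ _)
      (by
        have := congrArg Subtype.val hc'
        simpa [MvPolynomial.smul_eq_C_mul, mul_comm] using this) t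
    simpa using h
  have := finite_XSub p n 0 (Nat.zero_le n)
  -- The independent family has the size of both upper bounds for the dimension.
  have h1 := hli.fintype_card_le_finrank
  have h2 := finrank_XSub_le_digitSum p n
  have h3 := finrank_XSub_le_card p n
  rw [Fintype.card_coe] at h1
  have hne : Nonempty U := Finset.Nonempty.to_subtype (Finset.card_pos.1 (by omega))
  exact ⟨U, hc, hn, basisOfLinearIndependentOfCardEqFinrank hli
    (by rw [Fintype.card_coe]; omega), fun t => by simp⟩

theorem finrank_XSub_zero (p : ℕ) [Fact p.Prime] (n : ℕ) :
    Module.finrank (ZMod p) (XSub p n 0) = min (digitSum p n) p + 1 := by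
  obtain ⟨U, hc, -, B, -⟩ := exists_basis_linForm_pow p n
  rw [Module.finrank_eq_card_basis B, Fintype.card_coe, hc]

/-- The multiplication `X_{n, n} ⊗ V_i → V_{n + i}` is injective if no carry occurs in the last
digit of `n + i` and this last digit is at most `Σ_p(n)`. -/
theorem linearDisjoint_XSub_V (p : ℕ) [hp : Fact p.Prime] (n i : ℕ)
    (hi : n % p + i < p) (hS : n % p + i ≤ digitSum p n) :
    (XSub p n 0).LinearDisjoint (V p i).toSubmodule := by
  obtain ⟨U, hc, hn, B, hB⟩ := exists_basis_linForm_pow p n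
  refine Submodule.LinearDisjoint.of_basis_left _ _ B ?_
  rw [LinearMap.ker_eq_bot']
  intro G hG
  ext t : 2
  refine eq_zero_of_sum_linForm_pow_mul_eq_zero p n i hi hS U (by omega) hn
    (fun t => (G t : Poly p)) (fun t => (G t).2) ?_ t
  rw [Submodule.mulLeftMap_apply, Finsupp.sum_fintype _ _ (by simp)] at hG
  simpa [hB] using hG

/-! ### The modules `X_{r - i, r}` -/

theorem sum_pow_sub_two_add (p : ℕ) [hp : Fact p.Prime] (l : ℕ) (hl : l < p) :
    ∑ b : ZMod p, b ^ (p - 2 + l) = if l = 1 then -1 else 0 := by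
  have h2 := hp.out.two_le
  split_ifs with h
  · rw [h, show p - 2 + 1 = p - 1 by omega,
      ← Finset.sum_erase_add _ _ (Finset.mem_univ (0 : ZMod p)), zero_pow (by omega), add_zero,
      Finset.sum_congr rfl (g := fun _ => (1 : ZMod p))
        (fun b hb => ZMod.pow_card_sub_one_eq_one (Finset.ne_of_mem_erase hb))]
    simp [ZMod.card, Nat.cast_sub (show 1 ≤ p by omega)]
  · rcases Nat.eq_zero_or_pos l with rfl | hl0
    · exact FiniteField.sum_pow_lt_card_sub_one (ZMod p) _ (by rw [ZMod.card]; omega)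
    -- For `2 ≤ l` the exponent `p - 2 + l` may be lowered to `l - 1 < p - 1`.
    · rw [Finset.sum_congr rfl (g := fun b : ZMod p => b ^ (l - 1)) fun b _ => ?_]
      · exact FiniteField.sum_pow_lt_card_sub_one (ZMod p) _ (by rw [ZMod.card]; omega)
      · rw [show p - 2 + l = p + (l - 2) by omega, pow_add, ZMod.pow_card, ← pow_succ']
        congr 1
        omega

/-- Summing the translates of `X ^ (r - j - 1) Y ^ (j + 1)` under `Y ↦ bX + Y` against
`b ^ (p - 2)` isolates the multiple `-(j + 1) X ^ (r - j) Y ^ j`. -/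
theorem mono_mem_XSub_succ (p : ℕ) [hp : Fact p.Prime] (r j : ℕ) (hj : j + 1 < p)
    (hr : j + 1 ≤ r) : mono p r j ∈ XSub p r (j + 1) := by
  have key : ∑ b : ZMod p, (b ^ (p - 2)) • ((MvPolynomial.X 0 : Poly p) ^ (r - (j + 1)) *
      (MvPolynomial.C b * MvPolynomial.X 0 + MvPolynomial.X 1) ^ (j + 1)) ∈
        XSub p r (j + 1) := by
    refine Submodule.sum_mem _ fun b _ => Submodule.smul_mem _ _ ?_
    have hdet : IsUnit (!![1, b; 0, 1] : Mat p) := by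
      rw [Matrix.isUnit_iff_isUnit_det]
      simp [Matrix.det_fin_two]
    obtain ⟨γ, hγ⟩ := hdet
    refine Submodule.subset_span ⟨γ, ?_⟩
    simp only [hγ, polyRep_mono]
    simp
  have h2 : ∑ b : ZMod p, (b ^ (p - 2)) • ((MvPolynomial.X 0 : Poly p) ^ (r - (j + 1)) *
      (MvPolynomial.C b * MvPolynomial.X 0 + MvPolynomial.X 1) ^ (j + 1)) =
      (-((j + 1 : ℕ) : ZMod p)) • mono p r j := by
    have h3 : ∀ b : ZMod p, (b ^ (p - 2)) • ((MvPolynomial.X 0 : Poly p) ^ (r - (j + 1)) *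
        (MvPolynomial.C b * MvPolynomial.X 0 + MvPolynomial.X 1) ^ (j + 1)) =
        ∑ l ∈ Finset.range (j + 1 + 1), MvPolynomial.C (b ^ (p - 2 + l)) *
          ((MvPolynomial.X 0 : Poly p) ^ (r - (j + 1)) * (MvPolynomial.X 0 ^ l *
            MvPolynomial.X 1 ^ (j + 1 - l) * ((j + 1).choose l : Poly p))) := by
      intro b
      rw [add_pow, MvPolynomial.smul_eq_C_mul, Finset.mul_sum, Finset.mul_sum]
      refine Finset.sum_congr rfl fun l _ => ?_
      rw [mul_pow, pow_add, map_mul, map_pow, map_pow]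
      ring
    simp_rw [h3]
    rw [Finset.sum_comm]
    simp_rw [← Finset.sum_mul, ← map_sum]
    rw [Finset.sum_eq_single 1]
    · rw [sum_pow_sub_two_add p 1 (by omega), if_pos rfl, mono,
        show r - j = r - (j + 1) + 1 by omega, MvPolynomial.smul_eq_C_mul]
      simp
      ring
    · intro l hl hl1
      rw [sum_pow_sub_two_add p l (by have := Finset.mem_range.1 hl; omega), if_neg hl1]
      simp
    · intro h
      simp at h
  rw [h2] at key
  refine (Submodule.smul_mem_iff _ ?_).1 key
  rw [neg_ne_zero, Ne, ZMod.natCast_eq_zero_iff]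
  exact fun h => absurd (Nat.le_of_dvd (by omega) h) (by omega)

theorem XSub_le_XSub (p : ℕ) [Fact p.Prime] (r j i : ℕ) (hji : j ≤ i) (hi : i < p)
    (hr : i ≤ r) : XSub p r j ≤ XSub p r i := by
  induction i, hji using Nat.le_induction with
  | base => exact le_rfl
  | succ i hji ih =>
    refine (ih (by omega) (by omega)).trans (Submodule.span_le.2 ?_)
    rintro _ ⟨γ, rfl⟩
    exact smul_mem_XSub p r (i + 1) γ (mono_mem_XSub_succ p r i hi hr)

theorem mono_mul_mem_XSub (p : ℕ) [Fact p.Prime] (r i : ℕ) (hi : i < p) (hr : i ≤ r) {F : Poly p}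
    (hF : F.IsHomogeneous i) : mono p (r - i) 0 * F ∈ XSub p r i := by
  rw [F.as_sum, Finset.mul_sum]
  refine Submodule.sum_mem _ fun m hm => ?_
  have hdeg : m 0 + m 1 = i := by
    have := hF (MvPolynomial.mem_support_iff.1 hm)
    simpa [Finsupp.weight_apply, Finsupp.sum_fintype, Fin.sum_univ_two] using this
  have hmem : mono p r (m 1) ∈ XSub p r i := by
    refine XSub_le_XSub p r (m 1) i (by omega) hi hr (Submodule.subset_span ⟨1, ?_⟩)
    simp
  convert Submodule.smul_mem _ (MvPolynomial.coeff m F) hmem using 1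
  rw [MvPolynomial.monomial_eq, MvPolynomial.smul_eq_C_mul, mono, mono,
    show r - m 1 = r - i + m 0 by omega, Finsupp.prod_fintype _ _ (by simp), Fin.prod_univ_two,
    pow_add]
  simp only [Nat.sub_zero, pow_zero]
  ring

theorem polyRep_map_mul (p : ℕ) (m : Mat p) (F G : Poly p) :
    polyRep p m (F * G) = polyRep p m F * polyRep p m G := by
  simp only [polyRep_apply, map_mul]

/-- `X_{r - i, r}` is the image of the multiplication `X_{r - i, r - i} ⊗ V_i → V_r`. -/
theorem XSub_mul_V (p : ℕ) [Fact p.Prime] (r i : ℕ) (hi : i < p) (hr : i ≤ r) :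
    XSub p (r - i) 0 * (V p i).toSubmodule = XSub p r i := by
  apply le_antisymm
  · rw [Submodule.mul_le]
    intro E hE F hF
    induction hE using Submodule.span_induction with
    | mem x hx =>
      obtain ⟨γ, rfl⟩ := hx
      have h := smul_mem_XSub p r i γ (mono_mul_mem_XSub p r i hi hr
        ((V p i).apply_mem_toSubmodule ((γ⁻¹ : (Mat p)ˣ) : Mat p) hF))
      rwa [polyRep_map_mul, ← polyRep_mul, Units.mul_inv, map_one, Module.End.one_apply] at h
    | zero => simp
    | add x y _ _ hx hy =>
      rw [add_mul]
      exact add_mem hx hy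
    | smul c x _ hx =>
      rw [smul_mul_assoc]
      exact Submodule.smul_mem _ _ hx
  · refine Submodule.span_le.2 ?_
    rintro _ ⟨γ, rfl⟩
    have e : mono p r i = mono p (r - i) 0 * mono p i i := by simp [mono]
    simp only [e, polyRep_map_mul, SetLike.mem_coe]
    exact Submodule.mul_mem_mul (Submodule.subset_span ⟨γ, rfl⟩)
      (XSub_le_V p i i le_rfl (Submodule.subset_span ⟨γ, rfl⟩))

theorem linearDisjoint_of_le_digitSum (p : ℕ) [hp : Fact p.Prime] (r i : ℕ) (hi : i ≤ r % p)
    (hS : r % p ≤ digitSum p (r - i)) :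
    (XSub p (r - i) 0).LinearDisjoint (V p i).toSubmodule := by
  have hmod := Nat.mod_lt r hp.out.pos
  have h1 : (r - i) % p = r % p - i := by
    have h2 : r - i = r % p - i + p * (r / p) := by
      have := Nat.mod_add_div r p
      omega
    rw [h2, Nat.add_mul_mod_self_left, Nat.mod_eq_of_lt (by omega)]
  exact linearDisjoint_XSub_V p (r - i) i (by omega) (by omega)

theorem finrank_XSub_of_le_digitSum (p : ℕ) [hp : Fact p.Prime] (r i : ℕ) (hi : i ≤ r % p)
    (hS : r % p ≤ digitSum p (r - i)) :
    Module.finrank (ZMod p) (XSub p r i) = (i + 1) * (min (digitSum p (r - i)) p + 1) := by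
  have hip : i < p := hi.trans_lt (Nat.mod_lt r hp.out.pos)
  have e := (linearDisjoint_of_le_digitSum p r i hi hS).mulMap.finrank_eq
  rw [XSub_mul_V p r i hip (hi.trans (Nat.mod_le r p)), Module.finrank_tensorProduct,
    finrank_XSub_zero, finrank_V] at e
  rw [← e, mul_comm]

/-- Multiplication is an isomorphism of `M`-modules from `X_{r - i, r - i} ⊗ V_i` onto
`X_{r - i, r}` whenever it is injective. -/
theorem nonempty_equiv_of_linearDisjoint (p : ℕ) [hp : Fact p.Prime] (r i : ℕ) (hi : i < p)
    (hr : i ≤ r) (H : (XSub p (r - i) 0).LinearDisjoint (V p i).toSubmodule) :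
    Nonempty (Representation.Equiv (X p r i hi).toRepresentation
      ((XTop p (r - i)).toRepresentation.tprod (V p i).toRepresentation)) := by
  let e : ((XTop p (r - i)).toSubmodule ⊗[ZMod p] (V p i).toSubmodule) ≃ₗ[ZMod p]
      (X p r i hi).toSubmodule :=
    H.mulMap ≪≫ₗ LinearEquiv.ofEq _ _ (XSub_mul_V p r i hi hr)
  refine ⟨(Representation.Equiv.mk e fun m => ?_).symm⟩
  refine TensorProduct.ext' fun E F => Subtype.ext ?_
  exact (polyRep_map_mul p m E F).symm

/-- `X_{r - i, r}` lies in the product of `V_{r₀}` and `X_{r - r₀, r - r₀}`. -/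
theorem XSub_le_V_mul (p r r₀ i : ℕ) (hi : i ≤ r₀) (hr : r₀ ≤ r) :
    XSub p r i ≤ (V p r₀).toSubmodule * XSub p (r - r₀) 0 := by
  refine Submodule.span_le.2 ?_
  rintro _ ⟨γ, rfl⟩
  have e : mono p r i = mono p r₀ i * mono p (r - r₀) 0 := by
    rw [mono, mono, mono, show r - i = r₀ - i + (r - r₀) by omega, pow_add]
    simp only [Nat.sub_zero, pow_zero]
    ring
  simp only [e, polyRep_map_mul, SetLike.mem_coe]
  exact Submodule.mul_mem_mul (XSub_le_V p r₀ i hi (Submodule.subset_span ⟨γ, rfl⟩))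
    (Submodule.subset_span ⟨γ, rfl⟩)

theorem digitSum_sub_digitSum (p : ℕ) [hp : Fact p.Prime] (r i : ℕ) (hi : i ≤ r % p) :
    digitSum p (r - i) = r % p - i + digitSum p (r - r % p) := by
  have hmod := Nat.mod_lt r hp.out.pos
  have h1 := Nat.mod_add_div r p
  rw [show r - i = r % p - i + p * (r / p) by omega,
    show r - r % p = 0 + p * (r / p) by omega,
    digitSum_add_mul p _ _ (by omega) hp.out.one_lt,
    digitSum_add_mul p _ _ (by omega) hp.out.one_lt, zero_add]

/-- For `s = Σ_p(r - r₀) ≤ i ≤ r₀` the modules `X_{r - s, r} ≤ X_{r - i, r}` agree: the first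
already has the dimension of `V_{r₀} X_{r - r₀, r - r₀}`, which contains the second. -/
theorem XSub_eq_of_digitSum_le (p : ℕ) [hp : Fact p.Prime] (r i : ℕ) (hi : i ≤ r % p)
    (hs : digitSum p (r - r % p) ≤ i) :
    XSub p r i = XSub p r (digitSum p (r - r % p)) := by
  have hmod := Nat.mod_lt r hp.out.pos
  have hrr := Nat.mod_le r p
  set s := digitSum p (r - r % p) with hs'
  have hsum := digitSum_sub_digitSum p r s (by omega)
  have h1 := finrank_XSub_of_le_digitSum p r s (by omega) (by omega)
  have hW : Module.finrank (ZMod p)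
      ↥((V p (r % p)).toSubmodule * XSub p (r - r % p) 0) ≤ (r % p + 1) * (s + 1) := by
    have := finite_XSub p (r - r % p) 0 (Nat.zero_le _)
    rw [← Submodule.mulMap_range]
    refine (LinearMap.finrank_range_le _).trans ?_
    rw [Module.finrank_tensorProduct, finrank_V]
    exact Nat.mul_le_mul_left _ (finrank_XSub_le_digitSum p _)
  have hfin : Module.Finite (ZMod p)
      ↥((V p (r % p)).toSubmodule * XSub p (r - r % p) 0) := by
    have := finite_XSub p (r - r % p) 0 (Nat.zero_le _)
    rw [← Submodule.mulMap_range]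
    infer_instance
  have hle := Submodule.finrank_mono (XSub_le_V_mul p r (r % p) i hi hrr)
  have := finite_XSub p r i (by omega)
  refine (Submodule.eq_of_le_of_finrank_le
    (XSub_le_XSub p r s i hs (by omega) (by omega)) ?_).symm
  -- Here `Σ_p(r - s) = (r₀ - s) + s = r₀`.
  rw [h1, show min (digitSum p (r - s)) p = r % p by omega]
  linarith

end MonomialModules

theorem mainTheorem2 (p : ℕ) [Fact p.Prime] (hp : 3 ≤ p) (r r₀ i : ℕ) (hr : p ≤ r)
    (hr₀ : r₀ = r % p) (hip : i < p) (hi : i ≤ r₀) :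
    (r₀ ≤ MonomialModules.digitSum p (r - i) →
      Nonempty (Representation.Equiv
        (MonomialModules.X p r i hip).toRepresentation
        ((MonomialModules.XTop p (r - i)).toRepresentation.tprod
          (MonomialModules.V p i).toRepresentation))) ∧
    (MonomialModules.digitSum p (r - i) < r₀ →
      Nonempty (Representation.Equiv
        (MonomialModules.X p r i hip).toRepresentation
        ((MonomialModules.XTop p (r - MonomialModules.digitSum p (r - r₀))).toRepresentation.tprod
          (MonomialModules.V p (MonomialModules.digitSum p (r - r₀))).toRepresentation))) ∧
    (MonomialModules.digitSum p (r - i) < r₀ →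
      Module.finrank (ZMod p) (MonomialModules.X p r i hip).toSubmodule =
        (r₀ + 1) * (MonomialModules.digitSum p (r - r₀) + 1)) ∧
    (r₀ ≤ MonomialModules.digitSum p (r - i) → MonomialModules.digitSum p (r - i) ≤ p →
      Module.finrank (ZMod p) (MonomialModules.X p r i hip).toSubmodule =
        (i + 1) * (MonomialModules.digitSum p (r - i) + 1)) ∧
    (p ≤ MonomialModules.digitSum p (r - i) →
      Module.finrank (ZMod p) (MonomialModules.X p r i hip).toSubmodule =
        (i + 1) * (p + 1)) := by
  have hip₀ := Nat.mod_lt r (Fact.out : p.Prime).pos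
  have hrr := Nat.mod_le r p
  subst hr₀
  have hsum := MonomialModules.digitSum_sub_digitSum p r i hi
  refine ⟨fun h => ?_, fun h => ?_, fun h => ?_, fun h h' => ?_, fun h => ?_⟩
  · exact MonomialModules.nonempty_equiv_of_linearDisjoint p r i hip (by omega)
      (MonomialModules.linearDisjoint_of_le_digitSum p r i hi h)
  · have heq := MonomialModules.XSub_eq_of_digitSum_le p r i hi (by omega)
    set s := MonomialModules.digitSum p (r - r % p)
    have hX : MonomialModules.X p r i hip = MonomialModules.X p r s (by omega) :=
      Subrepresentation.toSubmodule_injective heq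
    rw [hX]
    have hs := MonomialModules.digitSum_sub_digitSum p r s (by omega)
    exact MonomialModules.nonempty_equiv_of_linearDisjoint p r s (by omega) (by omega)
      (MonomialModules.linearDisjoint_of_le_digitSum p r s (by omega) (by omega))
  · change Module.finrank (ZMod p) (MonomialModules.XSub p r i) = _
    rw [MonomialModules.XSub_eq_of_digitSum_le p r i hi (by omega)]
    set s := MonomialModules.digitSum p (r - r % p)
    have hs := MonomialModules.digitSum_sub_digitSum p r s (by omega)
    rw [MonomialModules.finrank_XSub_of_le_digitSum p r s (by omega) (by omega),
      show min (MonomialModules.digitSum p (r - s)) p = r % p by omega, mul_comm]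
  · rw [← min_eq_left h']
    exact MonomialModules.finrank_XSub_of_le_digitSum p r i hi h
  · have := MonomialModules.finrank_XSub_of_le_digitSum p r i hi (by omega)
    rwa [min_eq_right h] at this
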